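/- Let $m,n$ be positive integers with $m\le n$ and let $U$ be an open subset of $\mathbf R^n$. Let $\mathbf G(n,m)$ be the Grassmann manifold of $m$-dimensional linear subspaces of $\mathbf R^n$. For a locally compact Hausdorff space $X$, let $\mathscr K(X)$ be the space of continuous real-valued functions on $X$ with compact support, with the finest locally convex topology for which the inclusions of the spaces $\{f\in\mathscr K(X):\operatorname{spt} f\subset K\}$ (with the supremum norm), $K\subset X$ compact, are continuous. Let $\mathscr K(X)^*$ be its dual, the space of Daniell integrals on $\mathscr K(X)$. The strong topology on $\mathscr K(X)^*$ is the locally convex topology with local base at $0$ given by the sets $\{\mu : |\mu(f)|<r \text{ for all } f\in B\}$, where $r>0$ and $B$ is a bounded subset of $\mathscr K(X)$. Let $\mathbf V_m(U)$ be the set of $m$-dimensional varifolds in $U$, that is, of all monotone $V\in\mathscr K(U\times\mathbf G(n,m))^*$ (equivalently, of all Radon measures on $U\times \mathbf G(n,m)$). If $A\subset U$ is $\mathscr H^m$ measurable and meets every compact subset of $U$ in an $(\mathscr H^m,m)$ rectifiable set, let $\mathbf v(A)\in\mathbf V_m(U)$ be given by $$\mathbf v(A)(f)=\int_A f\bigl(x,\operatorname{Tan}^m(\mathscr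 H^m\llcorner A,x)\bigr)\,d\mathscr H^m x\qquad\text{for } f\in\mathscr K(U\times\mathbf G(n,m)),$$ where $\operatorname{Tan}^m$ denotes the approximate tangent cone, which is an $m$-dimensional subspace for $\mathscr H^m$ almost all $x\in A$. A varifold $V\in\mathbf V_m(U)$ is rectifiable, $V\in\mathbf{RV}_m(U)$ [integral, $V\in\mathbf{IV}_m(U)$], if $V=\sum_{i=1}^\infty c_i\,\mathbf v(A_i)$ for some positive real numbers [positive integers] $c_1,c_2,\dots$ and some such sets $A_1,A_2,\dots$. Then $\mathbf{RV}_m(U)$ and $\mathbf{IV}_m(U)$ are closed subsets of $\mathbf V_m(U)$ with respect to the strong topology. -/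

import Mathlib

open Set Filter Topology MeasureTheory TopologicalSpace
open scoped CompactlySupported ENNReal NNReal

noncomputable section

/-! ### Daniell integrals and the strong topology -/

namespace Daniell

variable (X : Type*) [TopologicalSpace X]

/-- Continuous real-valued functions on `X` whose support is compact and contained in `K`. -/
abbrev SupportedIn (K : Compacts X) : Type _ :=
  {f : C_c(X, ℝ) // tsupport f ⊆ (K : Set X)}

/-- The topology of uniform convergence on the functions supported in `K`. -/
@[reducible]
def supTopology (K : Compacts X) : TopologicalSpace (SupportedIn X K) :=
  TopologicalSpace.induced (fun f => f.1.toBoundedContinuousFunction) inferInstance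

/-- The inductive limit topology on `C_c(X, ℝ)` in the category of topological spaces. -/
@[reducible]
def inductiveTopology : TopologicalSpace C_c(X, ℝ) :=
  ⨆ K : Compacts X, TopologicalSpace.coinduced (fun f : SupportedIn X K => f.1) (supTopology X K)

/-- The space `𝒦(X)` of continuous functions with compact support carries its usual topology:
the finest locally convex vector space topology for which all inclusions of the spaces of
functions supported in a fixed compact set (with the supremum norm) are continuous. -/
instance instTopologicalSpace : TopologicalSpace C_c(X, ℝ) :=
  sInf {t : TopologicalSpace C_c(X, ℝ) | inductiveTopology X ≤ t ∧
    @IsTopologicalAddGroup C_c(X, ℝ) t _ ∧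
    @ContinuousSMul ℝ C_c(X, ℝ) _ _ t ∧
    @LocallyConvexSpace ℝ C_c(X, ℝ) _ _ _ _ t}

instance : IsTopologicalAddGroup C_c(X, ℝ) :=
  topologicalAddGroup_sInf fun _ ⟨_, ht, _, _⟩ => ht

instance : ContinuousSMul ℝ C_c(X, ℝ) :=
  continuousSMul_sInf fun _ ⟨_, _, ht, _⟩ => ht

instance : LocallyConvexSpace ℝ C_c(X, ℝ) :=
  .sInf fun _ ⟨_, _, _, ht⟩ => ht

/-- The space `𝒦(X)^*` of Daniell integrals: the dual of `𝒦(X)`. Its topology is the instance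
`ContinuousLinearMap.topologicalSpace`, that is, uniform convergence on the (von Neumann) bounded
subsets of `𝒦(X)`: the strong topology. -/
abbrev Integral : Type _ := C_c(X, ℝ) →L[ℝ] ℝ

end Daniell

namespace Varifold

/-- The Grassmann manifold `𝐆(n, m)` of `m`-dimensional linear subspaces of `ℝⁿ`. -/
def Gr (n m : ℕ) : Type :=
  {S : Submodule ℝ (EuclideanSpace ℝ (Fin n)) // Module.finrank ℝ S = m}

/-- A subspace is identified with the orthogonal projection onto it. -/
instance (n m : ℕ) : TopologicalSpace (Gr n m) :=
  TopologicalSpace.induced (fun S => S.1.starProjection)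
    (inferInstance : TopologicalSpace
      (EuclideanSpace ℝ (Fin n) →L[ℝ] EuclideanSpace ℝ (Fin n)))

instance (n m : ℕ) : MeasurableSpace (Gr n m) := borel _

instance (n m : ℕ) : BorelSpace (Gr n m) := ⟨rfl⟩

/-! ### Approximate tangent cones and rectifiable sets -/

section Tangent

variable {E : Type*} [NormedAddCommGroup E] [NormedSpace ℝ E] [MeasurableSpace E]

/-- The `m`-dimensional density of `φ` at `a` exists and equals `θ`:
`φ (B(a, r)) / (α(m) r ^ m) → θ` as `r → 0+`. -/
def HasDensity (m : ℕ) (φ : Measure E) (a : E) (θ : ℝ≥0∞) : Prop :=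
  Tendsto (fun r : ℝ => φ (Metric.closedBall a r) /
    volume (Metric.closedBall (0 : EuclideanSpace ℝ (Fin m)) r)) (𝓝[>] 0) (𝓝 θ)

/-- The tangent cone `Tan(S, a)` of a set `S` at a point `a`. -/
def tangentCone (S : Set E) (a : E) : Set E :=
  {v | ∀ ε : ℝ, 0 < ε → ∃ x ∈ S, ∃ r : ℝ, 0 < r ∧ ‖x - a‖ < ε ∧ ‖r • (x - a) - v‖ < ε}

/-- The approximate tangent cone `Tan^m(φ, a)`: the intersection of the cones `Tan(S, a)`
over all sets `S` whose complement has `m`-dimensional `φ` density `0` at `a`. -/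
def approxTangentCone (m : ℕ) (φ : Measure E) (a : E) : Set E :=
  {v | ∀ S : Set E, HasDensity m (φ.restrict Sᶜ) a 0 → v ∈ tangentCone S a}

end Tangent

/-- `A` is `(ℋ^m, m)` rectifiable: it has finite `ℋ^m` measure, and `ℋ^m` almost all of it is
covered by countably many Lipschitzian images of bounded subsets of `ℝ^m`. -/
def IsHausdorffRectifiable {n : ℕ} (m : ℕ) (A : Set (EuclideanSpace ℝ (Fin n))) : Prop :=
  μHE[m] A < ∞ ∧
  ∃ (B : ℕ → Set (EuclideanSpace ℝ (Fin m)))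
    (g : ℕ → EuclideanSpace ℝ (Fin m) → EuclideanSpace ℝ (Fin n)),
    (∀ i, Bornology.IsBounded (B i)) ∧ (∀ i, ∃ C : ℝ≥0, LipschitzOnWith C (g i) (B i)) ∧
    μHE[m] (A \ ⋃ i, g i '' B i) = 0

variable {n : ℕ} (m : ℕ) (U : Opens (EuclideanSpace ℝ (Fin n)))

/-- `A` is an `ℋ^m` measurable subset of `U` which meets every compact subset of `U` in an
`(ℋ^m, m)` rectifiable set. -/
def IsLocallyRectifiable (A : Set U) : Prop :=
  NullMeasurableSet A (μHE[m] : Measure U) ∧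
  ∀ K : Set U, IsCompact K → IsHausdorffRectifiable m (Subtype.val '' (A ∩ K))

/-- `T` is a Borel representative of the tangent plane map `x ↦ Tan^m(ℋ^m ⌞ A, x)`, which is
defined at `ℋ^m` almost all points of `A`. -/
def IsTangentField (A : Set U) (T : U → Gr n m) : Prop :=
  Measurable T ∧
  ∀ᵐ x ∂((μHE[m] : Measure U).restrict A),
    ((T x).1 : Set (EuclideanSpace ℝ (Fin n))) =
      approxTangentCone m (((μHE[m] : Measure U).restrict A).map Subtype.val)
        (x : EuclideanSpace ℝ (Fin n))

/-! ### Varifolds -/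

end Varifold

open Varifold

variable {n : ℕ} (m : ℕ) (U : Opens (EuclideanSpace ℝ (Fin n)))

/-- The space `𝐕_m(U)` of `m`-dimensional varifolds in `U`: Radon measures on `U × 𝐆(n, m)`, that
is, monotone Daniell integrals, with the strong topology (inherited from the Daniell integrals). -/
abbrev VarifoldSpace : Type :=
  {V : Daniell.Integral (U × Gr n m) // ∀ f : C_c(U × Gr n m, ℝ), (∀ z, 0 ≤ f z) → 0 ≤ V f}

variable {m U}

/-- `V = ∑ i, c i • 𝐯(A i)` for some sequence of `ℋ^m` measurable sets `A i` which meet every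
compact subset of `U` in an `(ℋ^m, m)` rectifiable set. Here `𝐯(A)` is the varifold with
`𝐯(A)(f) = ∫_A f(x, Tan^m(ℋ^m ⌞ A, x)) dℋ^m x`. -/
def VarifoldSpace.IsSum (V : VarifoldSpace m U) (c : ℕ → ℝ) : Prop :=
  ∃ (A : ℕ → Set U) (T : ℕ → U → Gr n m),
    (∀ i, IsLocallyRectifiable m U (A i)) ∧ (∀ i, IsTangentField m U (A i) (T i)) ∧
    ∀ f : C_c(U × Gr n m, ℝ),
      HasSum (fun i => c i * ∫ x in A i, f (x, T i x) ∂(μHE[m] : Measure U)) (V.1 f)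

variable (m U)

/-- The class `𝐑𝐕_m(U)` of rectifiable varifolds. -/
def rectifiableVarifolds : Set (VarifoldSpace m U) :=
  {V | ∃ c : ℕ → ℝ, (∀ i, 0 < c i) ∧ V.IsSum c}

/-- The class `𝐈𝐕_m(U)` of integral varifolds. -/
def integralVarifolds : Set (VarifoldSpace m U) :=
  {V | ∃ c : ℕ → ℕ, (∀ i, 0 < c i) ∧ V.IsSum (fun i => (c i : ℝ))}

end

noncomputable section

/-! ### Strong convergence as uniform convergence on test functions with fixed compact support. -/

namespace Daniell

variable {X : Type*} [TopologicalSpace X]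

/-! For compact `K`, the test functions bounded by `1` and supported in `K` form a bounded set.
Hence strong convergence is uniform on them (`eventually_nhds_forall_abs_sub_le`), which for the
representing Radon measures means convergence in total variation over the interior of `K`
(`measure_le_add_of_forall_integral_le`). Null sets and values of densities therefore survive in the
limit, which fails under weak convergence.

Let `V` lie in the closure of one of the two classes. Choose members `W j` of the class within `1 /
(j + 1)` of `V` on the `j`-th set of a compact exhaustion, and let `R` be the countable union of all
rectifiable sets occurring in the `W j`. Two of these sets have the same approximate tangent cone at
almost all common points: a Radon measure has `m`-dimensional density zero at `ℋ^m` almost all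
points of any set that it does not charge (`ae_tendsto_measure_closedBall_div_of_measure_eq_zero`).
So the tangent fields glue to one Borel map `S`, and every `W j` is carried by the graph of `S` over
`R`. Sets null for every `W j` are null for `V`. Hence `V` is carried by the same graph and its
projection to `U` is absolutely continuous with respect to the σ-finite measure `ℋ^m ⌞ R`. By
Radon–Nikodym, `V` is the lift under `x ↦ (x, S x)` of `θ ℋ^m ⌞ R`
(`exists_density_of_mem_closure`).

Any decomposition of `θ` into positive multiples of characteristic functions of Borel sets presents
`V` as a sum of the required form (`isSum_of_density`). Every measurable `θ` has one, which settles
the rectifiable case. In the integral case `θ` is locally an `L¹` limit of integer-valued densities,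
hence integer-valued almost everywhere (`ae_mem_range_natCast_of_approx`), and its level sets give
the decomposition. -/

theorem inductiveTopology_le : inductiveTopology X ≤ instTopologicalSpace X :=
  le_sInf fun _ ht => ht.1

theorem continuous_supportedIn_val (K : Compacts X) :
    @Continuous _ _ (supTopology X K) (instTopologicalSpace X) (fun f : SupportedIn X K => f.1) :=
  continuous_iff_coinduced_le.2 ((le_iSup (fun K : Compacts X =>
    TopologicalSpace.coinduced (fun f : SupportedIn X K => f.1) (supTopology X K)) K).trans
      inductiveTopology_le)

/-- A neighbourhood of zero in `𝒦(X)` contains all uniformly small functions supported in a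
given compact set. -/
theorem exists_pos_forall_mem_of_mem_nhds_zero (K : Compacts X) {N : Set C_c(X, ℝ)}
    (hN : N ∈ 𝓝 (0 : C_c(X, ℝ))) :
    ∃ δ : ℝ, 0 < δ ∧ ∀ f : C_c(X, ℝ), tsupport f ⊆ K → (∀ x, |f x| ≤ δ) → f ∈ N := by
  let := supTopology X K
  have h0 : tsupport (0 : C_c(X, ℝ)) ⊆ (K : Set X) := by
    simp [tsupport]
  have h1 : (fun f : SupportedIn X K => f.1) ⁻¹' N ∈ 𝓝 (⟨0, h0⟩ : SupportedIn X K) :=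
    (continuous_supportedIn_val K).continuousAt.preimage_mem_nhds hN
  rw [nhds_induced, mem_comap] at h1
  obtain ⟨t, ht, hts⟩ := h1
  obtain ⟨ε, hε, hb⟩ := Metric.mem_nhds_iff.1 ht
  refine ⟨ε / 2, by positivity, fun f hf hfδ => ?_⟩
  have : (⟨f, hf⟩ : SupportedIn X K) ∈ (fun f : SupportedIn X K => f.1) ⁻¹' N := by
    apply hts
    apply hb
    rw [Metric.mem_ball]
    refine lt_of_le_of_lt ?_ (half_lt_self hε)
    rw [BoundedContinuousFunction.dist_le (by positivity)]
    intro x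
    simpa using hfδ x
  exact this

/-- This puts the unit ball of each space of functions supported in `K` among the bounded sets that
define the strong topology; scaling by a large scalar moves it into any neighbourhood of zero. -/
theorem isVonNBounded_supportedIn (K : Compacts X) :
    Bornology.IsVonNBounded ℝ {f : C_c(X, ℝ) | tsupport f ⊆ K ∧ ∀ x, |f x| ≤ 1} := by
  intro N hN
  obtain ⟨δ, hδ, h⟩ := exists_pos_forall_mem_of_mem_nhds_zero K hN
  refine Absorbs.of_norm ⟨δ⁻¹, fun a ha f hf => ?_⟩
  have ha0 : 0 < ‖a‖ := lt_of_lt_of_le (by positivity) ha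
  have ha1 : a ≠ 0 := norm_pos_iff.1 ha0
  refine ⟨a⁻¹ • f, h _ ?_ ?_, by simp [smul_smul, ha1]⟩
  · refine (closure_mono fun x hx => ?_).trans hf.1
    simp only [Function.mem_support, CompactlySupportedContinuousMap.coe_smul, Pi.smul_apply,
      smul_eq_mul, ne_eq, mul_eq_zero, not_or] at hx ⊢
    exact hx.2
  · intro x
    have : |a|⁻¹ ≤ δ := inv_le_of_inv_le₀ hδ ha
    calc |(a⁻¹ • f) x| = |a|⁻¹ * |f x| := by simp [abs_mul, abs_inv]
      _ ≤ δ * 1 := by gcongr; exact hf.2 x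
      _ = δ := mul_one δ

theorem eventually_nhds_forall_mem_abs_sub_le {E : Type*} [AddCommGroup E] [Module ℝ E]
    [TopologicalSpace E] (V : E →L[ℝ] ℝ) {B : Set E} (hB : Bornology.IsVonNBounded ℝ B)
    {ε : ℝ} (hε : 0 < ε) : ∀ᶠ W in 𝓝 V, ∀ f ∈ B, |W f - V f| ≤ ε := by
  have h := ContinuousLinearMap.eventually_nhds_zero_mapsTo (σ := RingHom.id ℝ)
    hB (Metric.closedBall_mem_nhds (0 : ℝ) hε)
  have h2 : Tendsto (fun W : E →L[ℝ] ℝ => W - V) (𝓝 V) (𝓝 0) := by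
    simpa using (continuous_id.sub continuous_const).tendsto (f := fun W : E →L[ℝ] ℝ => W - V) V
  filter_upwards [h2.eventually h] with W hW f hf
  simpa using hW hf

/-- Strong convergence is uniform on the functions bounded by `1` and supported in a given
compact set. -/
theorem eventually_nhds_forall_abs_sub_le (V : Integral X) (K : Compacts X) {ε : ℝ} (hε : 0 < ε) :
    ∀ᶠ W in 𝓝 V, ∀ f : C_c(X, ℝ), tsupport f ⊆ K → (∀ x, |f x| ≤ 1) → |W f - V f| ≤ ε := by
  filter_upwards [eventually_nhds_forall_mem_abs_sub_le V (isVonNBounded_supportedIn K) hε]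
    with W hW f hf hf1 using hW f ⟨hf, hf1⟩

end Daniell

namespace Varifold

/-! ### The Grassmann manifold as a topological space -/

variable {n m : ℕ}

theorem Gr.isEmbedding_starProjection : IsEmbedding fun S : Gr n m => S.1.starProjection :=
  ⟨⟨rfl⟩, fun _ _ h => Subtype.ext (Submodule.starProjection_inj.1 h)⟩

theorem trace_starProjection (S : Submodule ℝ (EuclideanSpace ℝ (Fin n))) :
    LinearMap.trace ℝ _ (S.starProjection : EuclideanSpace ℝ (Fin n) →ₗ[ℝ] _)
      = Module.finrank ℝ S := by
  refine LinearMap.IsProj.trace (p := S) ⟨fun x => ?_, fun x hx => ?_⟩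
  · exact Submodule.starProjection_apply_mem S x
  · exact Submodule.starProjection_eq_self_iff.2 hx

/-- The trace of a projection is its rank, so the dimension condition becomes a closed condition on
operators. This makes the Grassmannian compact, and hence also the cylinders `K ×ˢ univ` over
compact sets. -/
theorem Gr.range_starProjection :
    range (fun S : Gr n m => S.1.starProjection) =
      {P : EuclideanSpace ℝ (Fin n) →L[ℝ] EuclideanSpace ℝ (Fin n) | P * P = P ∧ star P = P ∧
        LinearMap.trace ℝ _ (P : EuclideanSpace ℝ (Fin n) →ₗ[ℝ] _) = m} := by
  ext P
  constructor
  · rintro ⟨S, rfl⟩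
    have h : IsStarProjection S.1.starProjection := isStarProjection_starProjection
    exact ⟨h.1, h.2, by rw [trace_starProjection, S.2]⟩
  · rintro ⟨h1, h2, h3⟩
    obtain ⟨K, _, rfl⟩ := isStarProjection_iff_eq_starProjection.1 ⟨h1, h2⟩
    rw [trace_starProjection] at h3
    exact ⟨⟨K, by exact_mod_cast h3⟩, rfl⟩

theorem Gr.isCompact_range_starProjection :
    IsCompact (range fun S : Gr n m => S.1.starProjection) := by
  refine Metric.isCompact_of_isClosed_isBounded ?_ ?_
  · rw [Gr.range_starProjection]
    have h : Continuous fun P : EuclideanSpace ℝ (Fin n) →L[ℝ] EuclideanSpace ℝ (Fin n) =>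
        LinearMap.trace ℝ _ (P : EuclideanSpace ℝ (Fin n) →ₗ[ℝ] _) :=
      ((LinearMap.trace ℝ (EuclideanSpace ℝ (Fin n))).comp
        (ContinuousLinearMap.coeLM ℝ)).continuous_of_finiteDimensional
    exact (isClosed_eq (by fun_prop) continuous_id).inter
      ((isClosed_eq continuous_star continuous_id).inter (isClosed_eq h continuous_const))
  · refine (Metric.isBounded_closedBall (x := 0) (r := 1)).subset ?_
    rintro _ ⟨S, rfl⟩
    simpa using Submodule.starProjection_norm_le S.1

instance : CompactSpace (Gr n m) :=
  ⟨Gr.isEmbedding_starProjection.isCompact_iff.2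
    (by rw [image_univ]; exact Gr.isCompact_range_starProjection)⟩

instance : T2Space (Gr n m) := Gr.isEmbedding_starProjection.t2Space

instance : SecondCountableTopology (Gr n m) :=
  Gr.isEmbedding_starProjection.secondCountableTopology

instance : MetrizableSpace (Gr n m) := Gr.isEmbedding_starProjection.metrizableSpace

end Varifold

namespace Varifold

/-! ### Densities with respect to Hausdorff measure -/

section Density

variable {Y : Type*} [MetricSpace Y] [SecondCountableTopology Y] [MeasurableSpace Y] [BorelSpace Y]

/-- The `5r`-covering estimate: a set all of whose points are centres of arbitrarily small closed
balls of large `φ` measure has small Hausdorff measure. -/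
theorem hausdorffMeasure_le_of_frequently_lt_measure_closedBall (m : ℕ) (φ : Measure Y)
    {t : ℝ≥0∞} (ht : t ≠ 0) (ht' : t ≠ ∞) {C O : Set Y} (hO : IsOpen O) (hCO : C ⊆ O)
    (hC : ∀ x ∈ C, ∃ᶠ r in 𝓝[>] (0 : ℝ), t * ENNReal.ofReal r ^ m ≤ φ (Metric.closedBall x r)) :
    μH[m] C ≤ 10 ^ m * t⁻¹ * φ O := by
  have key : ∀ k : ℕ, ∃ u : Set (Y × ℝ), u.Countable ∧
      (∀ p ∈ u, 0 < p.2 ∧ p.2 ≤ 1 / ((k : ℝ) + 1) ∧ Metric.closedBall p.1 p.2 ⊆ O ∧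
        t * ENNReal.ofReal p.2 ^ m ≤ φ (Metric.closedBall p.1 p.2)) ∧
      (u.PairwiseDisjoint fun p => Metric.closedBall p.1 p.2) ∧
      C ⊆ ⋃ p : u, Metric.closedBall p.1.1 (5 * p.1.2) := by
    intro k
    let F : Set (Y × ℝ) := {p | 0 < p.2 ∧ p.2 ≤ 1 / ((k : ℝ) + 1) ∧ Metric.closedBall p.1 p.2 ⊆ O ∧
        t * ENNReal.ofReal p.2 ^ m ≤ φ (Metric.closedBall p.1 p.2)}
    obtain ⟨u, huF, hdis, hcov⟩ := Vitali.exists_disjoint_subfamily_covering_enlargement_closedBall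
      F (fun p => p.1) (fun p => p.2) (1 / ((k : ℝ) + 1)) (fun p hp => hp.2.1) 5 (by norm_num)
    refine ⟨u, ?_, fun p hp => huF hp, hdis, fun x hx => ?_⟩
    · refine hdis.countable_of_nonempty_interior fun p hp => ?_
      exact ⟨p.1, interior_mono Metric.ball_subset_closedBall
        (by rw [Metric.isOpen_ball.interior_eq]; exact Metric.mem_ball_self (huF hp).1)⟩
    · obtain ⟨ρ, hρ, hρO⟩ := Metric.isOpen_iff.1 hO x (hCO hx)
      have hk : (0 : ℝ) < 1 / ((k : ℝ) + 1) := by positivity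
      have hev : ∀ᶠ r in 𝓝[>] (0 : ℝ), 0 < r ∧ r < min ρ (1 / ((k : ℝ) + 1)) :=
        Ioo_mem_nhdsGT (lt_min hρ hk)
      obtain ⟨r, hr1, hr0, hr2⟩ := ((hC x hx).and_eventually hev).exists
      have hF : (x, r) ∈ F := ⟨hr0, (hr2.trans_le (min_le_right _ _)).le,
        (Metric.closedBall_subset_ball (hr2.trans_le (min_le_left _ _))).trans hρO, hr1⟩
      obtain ⟨b, hb, hsub⟩ := hcov _ hF
      exact mem_iUnion.2 ⟨⟨b, hb⟩, hsub (Metric.mem_closedBall_self hr0.le)⟩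
  choose u huc hu hdis hcov using key
  have : ∀ k, Countable (u k) := fun k => (huc k).to_subtype
  -- The Vitali enlargement factor `5` doubles to a diameter of `10` radii, which is the source of
  -- `10 ^ m`.
  have hdiam : ∀ (k : ℕ) (p : u k),
      Metric.ediam (Metric.closedBall p.1.1 (5 * p.1.2)) ≤ 10 * ENNReal.ofReal p.1.2 := by
    intro k p
    rw [← Metric.closedEBall_ofReal (by have := (hu k p.1 p.2).1; positivity)]
    refine Metric.ediam_closedEBall_le.trans_eq ?_
    rw [ENNReal.ofReal_mul (by norm_num), ← mul_assoc]
    norm_num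
  have hlim : Tendsto (fun k : ℕ => 10 * ENNReal.ofReal (1 / ((k : ℝ) + 1))) atTop (𝓝 0) := by
    have h := ENNReal.tendsto_ofReal tendsto_one_div_add_atTop_nhds_zero_nat
    rw [ENNReal.ofReal_zero] at h
    simpa using ENNReal.Tendsto.const_mul h (Or.inr (by norm_num : (10 : ℝ≥0∞) ≠ ∞))
  refine (Measure.hausdorffMeasure_le_liminf_tsum (m : ℝ) C _ hlim
    (fun k (p : u k) => Metric.closedBall p.1.1 (5 * p.1.2))
    (Eventually.of_forall fun k p => (hdiam k p).trans ?_)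
    (Eventually.of_forall hcov)).trans ?_
  · gcongr
    exact (hu k p.1 p.2).2.1
  refine (liminf_le_liminf (v := fun _ => 10 ^ m * t⁻¹ * φ O)
    (Eventually.of_forall fun k => ?_)).trans_eq (liminf_const _)
  calc ∑' p : u k, Metric.ediam (Metric.closedBall p.1.1 (5 * p.1.2)) ^ (m : ℝ)
      ≤ ∑' p : u k, 10 ^ m * t⁻¹ * φ (Metric.closedBall p.1.1 p.1.2) := by
        refine ENNReal.tsum_le_tsum fun p => ?_
        rw [ENNReal.rpow_natCast]
        calc _ ≤ (10 * ENNReal.ofReal p.1.2) ^ m := by gcongr; exact hdiam k p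
          _ = 10 ^ m * t⁻¹ * (t * ENNReal.ofReal p.1.2 ^ m) := by
            rw [mul_pow, mul_assoc, ← mul_assoc t⁻¹, ENNReal.inv_mul_cancel ht ht', one_mul]
          _ ≤ _ := by gcongr; exact (hu k p.1 p.2).2.2.2
    _ = 10 ^ m * t⁻¹ * φ (⋃ p : u k, Metric.closedBall p.1.1 p.1.2) := by
        rw [ENNReal.tsum_mul_left, measure_iUnion]
        · intro p q hpq
          exact hdis k p.2 q.2 (fun h => hpq (Subtype.ext h))
        · exact fun p => Metric.isClosed_closedBall.measurableSet
    _ ≤ _ := by gcongr; exact iUnion_subset fun p => (hu k p.1 p.2).2.2.1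

/-- The points of `C` where the upper density exceeds a fixed threshold lie in open sets of
arbitrarily small `φ` measure, because `φ C = 0` and `φ` is outer regular. The covering estimate
then makes them `ℋ^m` null. -/
theorem ae_tendsto_measure_closedBall_div_of_measure_eq_zero (m : ℕ) (φ : Measure Y)
    [φ.OuterRegular] {C : Set Y} (hC : φ C = 0) :
    ∀ᵐ x ∂(μH[m] : Measure Y), x ∈ C → Tendsto (fun r : ℝ => φ (Metric.closedBall x r) /
      volume (Metric.closedBall (0 : EuclideanSpace ℝ (Fin m)) r)) (𝓝[>] 0) (𝓝 0) := by
  have hnull : ∀ k : ℕ, μH[m] {x ∈ C | ∃ᶠ r in 𝓝[>] (0 : ℝ),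
      ((k : ℝ≥0∞) + 1)⁻¹ * ENNReal.ofReal r ^ m ≤ φ (Metric.closedBall x r)} = 0 := by
    intro k
    have hk : ((k : ℝ≥0∞) + 1)⁻¹ ≠ 0 := by simp
    have hk' : ((k : ℝ≥0∞) + 1)⁻¹ ≠ ∞ := by simp
    have hM : 10 ^ m * ((k : ℝ≥0∞) + 1)⁻¹⁻¹ ≠ ∞ :=
      ENNReal.mul_ne_top (by simp) (by simp)
    refine le_antisymm (ge_of_tendsto (f := fun ε : ℝ≥0∞ => 10 ^ m * ((k : ℝ≥0∞) + 1)⁻¹⁻¹ * ε)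
      (x := 𝓝[>] 0) ?_ ?_) zero_le
    · have := ENNReal.Tendsto.const_mul (a := 10 ^ m * ((k : ℝ≥0∞) + 1)⁻¹⁻¹)
        (tendsto_id (α := ℝ≥0∞) (x := 𝓝 0)) (Or.inr hM)
      rw [mul_zero] at this
      exact this.mono_left nhdsWithin_le_nhds
    · filter_upwards [self_mem_nhdsWithin] with ε hε
      obtain ⟨O, hCO, hO, hOε⟩ := C.exists_isOpen_lt_of_lt ε (hC.trans_lt hε)
      refine (hausdorffMeasure_le_of_frequently_lt_measure_closedBall m φ hk hk' hO
        ((sep_subset _ _).trans hCO) fun x hx => hx.2).trans ?_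
      gcongr
  have hall := ae_all_iff.2 fun k => measure_eq_zero_iff_ae_notMem.1 (hnull k)
  filter_upwards [hall] with x hx hxC
  set α := volume (Metric.closedBall (0 : EuclideanSpace ℝ (Fin m)) 1) with hα
  have hα0 : α ≠ 0 := (Metric.measure_closedBall_pos _ _ one_pos).ne'
  rw [ENNReal.tendsto_nhds_zero]
  intro ε hε
  -- The thresholds compare with `r ^ m`, the density with the volume of a ball; the factor `α`
  -- accounts for the difference.
  obtain ⟨k, hk⟩ := ENNReal.exists_inv_nat_lt (a := ε * α) (mul_ne_zero hε.ne' hα0)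
  have h1 := hx k
  simp only [hxC, true_and, not_frequently, not_le] at h1
  filter_upwards [h1, self_mem_nhdsWithin] with r hr hr0
  have hvol : volume (Metric.closedBall (0 : EuclideanSpace ℝ (Fin m)) r)
      = ENNReal.ofReal r ^ m * α := by
    rw [Measure.addHaar_closedBall' _ _ hr0.le]
    simp [hα, ENNReal.ofReal_pow (le_of_lt hr0)]
  rw [hvol]
  have hr1 : ENNReal.ofReal r ^ m ≠ 0 := pow_ne_zero _ (by simpa using hr0)
  refine ENNReal.div_le_of_le_mul (hr.le.trans ?_)
  calc ((k : ℝ≥0∞) + 1)⁻¹ * ENNReal.ofReal r ^ m ≤ ε * α * ENNReal.ofReal r ^ m := by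
        gcongr
        exact (ENNReal.inv_le_inv.2 le_self_add).trans hk.le
    _ = ε * (ENNReal.ofReal r ^ m * α) := by ring

end Density

/-! ### Approximate tangent cones -/

section Tangent

variable {E : Type*} [NormedAddCommGroup E] [MeasurableSpace E]

theorem HasDensity.zero_mono {m : ℕ} {φ ψ : Measure E} {a : E} (h : HasDensity m ψ a 0)
    (hle : φ ≤ ψ) : HasDensity m φ a 0 :=
  tendsto_of_tendsto_of_tendsto_of_le_of_le tendsto_const_nhds h (fun _ => zero_le)
    fun _ => ENNReal.div_le_div_right (hle _) _

theorem HasDensity.add {m : ℕ} {φ ψ : Measure E} {a : E} {θ η : ℝ≥0∞} (h : HasDensity m φ a θ)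
    (h' : HasDensity m ψ a η) : HasDensity m (φ + ψ) a (θ + η) := by
  have := Tendsto.add h h'
  simpa only [HasDensity, Measure.add_apply, ENNReal.add_div] using this

/-- The sets `S` over which the cones are intersected are the same for `φ + ψ` and for `φ`, since
`ψ` restricted to `Sᶜ` has density zero in any case. -/
theorem approxTangentCone_add [NormedSpace ℝ E] {m : ℕ} {φ ψ : Measure E} {a : E}
    (h : HasDensity m ψ a 0) : approxTangentCone m (φ + ψ) a = approxTangentCone m φ a := by
  have key : ∀ S : Set E, HasDensity m ((φ + ψ).restrict Sᶜ) a 0 ↔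
      HasDensity m (φ.restrict Sᶜ) a 0 := fun S => by
    rw [Measure.restrict_add]
    refine ⟨fun h1 => h1.zero_mono (Measure.le_add_right le_rfl), fun h1 => ?_⟩
    simpa using h1.add (h.zero_mono (Measure.restrict_le_self (s := Sᶜ)))
  simp only [approxTangentCone, key]

end Tangent

instance {n : ℕ} (U : Opens (EuclideanSpace ℝ (Fin n))) : LocallyCompactSpace U :=
  U.isOpen.locallyCompactSpace

/-! ### Tangent fields and rectifiability of sets of locally finite Hausdorff measure. -/

section Hausdorff

variable {n : ℕ} (m : ℕ) {U : Opens (EuclideanSpace ℝ (Fin n))}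

theorem euclideanHausdorffMeasure_absolutelyContinuous {Y : Type*} [EMetricSpace Y]
    [MeasurableSpace Y] [BorelSpace Y] : (μHE[m] : Measure Y) ≪ μH[m] := by
  rw [Measure.euclideanHausdorffMeasure_def]
  exact Measure.smul_absolutelyContinuous

theorem ae_hasDensity_map_val_zero (φ : Measure U) [φ.OuterRegular] {C : Set U} (hC : φ C = 0) :
    ∀ᵐ x ∂(μHE[m] : Measure U), x ∈ C → HasDensity m (φ.map Subtype.val)
      (x : EuclideanSpace ℝ (Fin n)) 0 := by
  filter_upwards [(euclideanHausdorffMeasure_absolutelyContinuous m).ae_le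
    (ae_tendsto_measure_closedBall_div_of_measure_eq_zero m φ hC)] with x hx hxC
  refine (hx hxC).congr fun r => ?_
  rw [Measure.map_apply measurable_subtype_coe Metric.isClosed_closedBall.measurableSet]
  rfl

/-- The approximate tangent cones of two sets agree at almost all common points. -/
theorem ae_approxTangentCone_eq_inter {A B : Set U} (hB : NullMeasurableSet B (μHE[m] : Measure U))
    [((μHE[m] : Measure U).restrict (A \ B)).OuterRegular] :
    ∀ᵐ x ∂(μHE[m] : Measure U), x ∈ B →
      approxTangentCone m (((μHE[m] : Measure U).restrict A).map Subtype.val)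
        (x : EuclideanSpace ℝ (Fin n)) =
      approxTangentCone m (((μHE[m] : Measure U).restrict (A ∩ B)).map Subtype.val)
        (x : EuclideanSpace ℝ (Fin n)) := by
  -- The part of `A` outside `B` does not charge `B`, so it has density zero at almost all points of
  -- `B` and does not affect the cone there.
  have hz : ((μHE[m] : Measure U).restrict (A \ B)) B = 0 := by
    rw [Measure.restrict_apply₀ (hB.mono Measure.restrict_le_self)]
    simp
  filter_upwards [ae_hasDensity_map_val_zero m _ hz] with x hx hxB
  rw [← Measure.restrict_inter_add_sdiff₀ A hB, Measure.map_add _ _ measurable_subtype_coe,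
    approxTangentCone_add (hx hxB)]

variable {m}

theorem IsLocallyRectifiable.measure_inter_lt_top {A : Set U} (hA : IsLocallyRectifiable m U A)
    {K : Set U} (hK : IsCompact K) : (μHE[m] : Measure U) (A ∩ K) < ∞ := by
  rw [← isometry_subtype_coe.euclideanHausdorffMeasure_image]
  exact (hA.2 K hK).1

theorem isLocallyFiniteMeasure_restrict {A : Set U}
    (hA : ∀ K, IsCompact K → (μHE[m] : Measure U) (A ∩ K) < ∞) :
    IsLocallyFiniteMeasure ((μHE[m] : Measure U).restrict A) := by
  have : IsFiniteMeasureOnCompacts ((μHE[m] : Measure U).restrict A) := by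
    refine ⟨fun K hK => ?_⟩
    rw [Measure.restrict_apply hK.measurableSet, inter_comm]
    exact hA K hK
  exact isLocallyFiniteMeasure_of_isFiniteMeasureOnCompacts

/-- Both cones agree with that of `A ∩ B`. Local finiteness supplies the outer regularity of the
measures on the two differences. -/
theorem ae_approxTangentCone_eq {A B : Set U}
    (hA : NullMeasurableSet A (μHE[m] : Measure U))
    (hA' : ∀ K, IsCompact K → (μHE[m] : Measure U) (A ∩ K) < ∞)
    (hB : NullMeasurableSet B (μHE[m] : Measure U))
    (hB' : ∀ K, IsCompact K → (μHE[m] : Measure U) (B ∩ K) < ∞) :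
    ∀ᵐ x ∂(μHE[m] : Measure U), x ∈ A → x ∈ B →
      approxTangentCone m (((μHE[m] : Measure U).restrict A).map Subtype.val)
        (x : EuclideanSpace ℝ (Fin n)) =
      approxTangentCone m (((μHE[m] : Measure U).restrict B).map Subtype.val)
        (x : EuclideanSpace ℝ (Fin n)) := by
  have h1 : IsLocallyFiniteMeasure ((μHE[m] : Measure U).restrict (A \ B)) :=
    isLocallyFiniteMeasure_restrict fun K hK =>
      (measure_mono (inter_subset_inter_left _ sdiff_subset)).trans_lt (hA' K hK)
  have h2 : IsLocallyFiniteMeasure ((μHE[m] : Measure U).restrict (B \ A)) :=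
    isLocallyFiniteMeasure_restrict fun K hK =>
      (measure_mono (inter_subset_inter_left _ sdiff_subset)).trans_lt (hB' K hK)
  filter_upwards [ae_approxTangentCone_eq_inter m (A := A) hB,
    ae_approxTangentCone_eq_inter m (A := B) hA] with x h3 h4 hxA hxB
  rw [h3 hxB, h4 hxA, inter_comm]

/-- A tangent field of `A` describes the approximate tangent cones of `B` at almost all points
of `A ∩ B`. -/
theorem IsTangentField.ae_eq_approxTangentCone {A B : Set U} {T : U → Gr n m}
    (hT : IsTangentField m U A T) (hA : IsLocallyRectifiable m U A)
    (hB : NullMeasurableSet B (μHE[m] : Measure U))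
    (hB' : ∀ K, IsCompact K → (μHE[m] : Measure U) (B ∩ K) < ∞) :
    ∀ᵐ x ∂(μHE[m] : Measure U), x ∈ A → x ∈ B →
      ((T x).1 : Set (EuclideanSpace ℝ (Fin n))) =
      approxTangentCone m (((μHE[m] : Measure U).restrict B).map Subtype.val)
        (x : EuclideanSpace ℝ (Fin n)) := by
  filter_upwards [ae_approxTangentCone_eq hA.1 (fun K hK => hA.measure_inter_lt_top hK) hB hB',
    (ae_restrict_iff'₀ hA.1).1 hT.2] with x h1 h2 hxA hxB
  rw [h2 hxA, h1 hxA hxB]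

theorem IsTangentField.ae_eq {A B : Set U} {T S : U → Gr n m}
    (hT : IsTangentField m U A T) (hA : IsLocallyRectifiable m U A)
    (hS : IsTangentField m U B S) (hB : IsLocallyRectifiable m U B) :
    ∀ᵐ x ∂(μHE[m] : Measure U), x ∈ A → x ∈ B → T x = S x := by
  filter_upwards [hT.ae_eq_approxTangentCone hA hB.1 (fun K hK => hB.measure_inter_lt_top hK),
    (ae_restrict_iff'₀ hB.1).1 hS.2] with x h1 h2 hxA hxB
  exact Subtype.ext (SetLike.coe_injective ((h1 hxA hxB).trans (h2 hxB).symm))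

/-- A subset of locally finite measure of a countable union of locally rectifiable sets is
locally rectifiable. -/
theorem IsLocallyRectifiable.of_subset_iUnion {A : ℕ → Set U}
    (hA : ∀ i, IsLocallyRectifiable m U (A i)) {C : Set U}
    (hC : NullMeasurableSet C (μHE[m] : Measure U))
    (hC' : ∀ K, IsCompact K → (μHE[m] : Measure U) (C ∩ K) < ∞) (hCA : C ⊆ ⋃ i, A i) :
    IsLocallyRectifiable m U C := by
  refine ⟨hC, fun K hK => ⟨?_, ?_⟩⟩
  · rw [isometry_subtype_coe.euclideanHausdorffMeasure_image]
    exact hC' K hK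
  choose B g hB hg hnull using fun i => ((hA i).2 K hK).2
  refine ⟨fun k => B k.unpair.1 k.unpair.2, fun k => g k.unpair.1 k.unpair.2,
    fun k => hB _ _, fun k => hg _ _, ?_⟩
  refine measure_mono_null ?_ (measure_iUnion_null hnull)
  rintro _ ⟨⟨x, ⟨hxC, hxK⟩, rfl⟩, hx⟩
  obtain ⟨i, hi⟩ := mem_iUnion.1 (hCA hxC)
  refine mem_iUnion.2 ⟨i, ⟨x, ⟨hi, hxK⟩, rfl⟩, fun hx' => hx ?_⟩
  obtain ⟨j, hj⟩ := mem_iUnion.1 hx'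
  refine mem_iUnion.2 ⟨Nat.pair i j, ?_⟩
  simpa using hj

end Hausdorff

end Varifold

/-! ### Comparison of Radon measures, integer-valued densities, decomposition of densities. -/

namespace MeasureTheory

/-- Two Radon measures whose integrals nearly agree on all test functions between `0` and `1`
supported in `K` nearly agree on all Borel subsets of the interior of `K`. -/
theorem measure_le_add_of_forall_integral_le {X : Type*} [TopologicalSpace X] [T2Space X]
    [LocallyCompactSpace X] [MeasurableSpace X] [BorelSpace X] {μ ν : Measure X} [μ.Regular]
    [ν.Regular] {K : Set X} (hK : IsCompact K) {ε : ℝ}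
    (h : ∀ f : C_c(X, ℝ), tsupport f ⊆ K → (∀ x, 0 ≤ f x ∧ f x ≤ 1) →
      ∫ x, f x ∂μ ≤ ∫ x, f x ∂ν + ε) {E : Set X} (hE : MeasurableSet E) (hEK : E ⊆ interior K) :
    μ E ≤ ν E + ENNReal.ofReal ε := by
  have hEfin : μ E ≠ ∞ := (measure_mono (hEK.trans interior_subset)).trans_lt
    hK.measure_lt_top |>.ne
  rw [hE.measure_eq_iSup_isCompact_of_ne_top hEfin]
  refine iSup₂_le fun F hFE => iSup_le fun hF => ?_
  refine le_trans ?_ (add_le_add_left (measure_mono hFE) _)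
  rw [F.measure_eq_iInf_isOpen ν]
  simp only [ENNReal.iInf_add]
  refine le_iInf₂ fun G hFG => le_iInf fun hG => ?_
  have hcl : closure (G ∩ interior K) ⊆ K :=
    closure_minimal (inter_subset_right.trans interior_subset) hK.isClosed
  -- Inner regularity of `μ` replaces `E` by a compact `F`, outer regularity of `ν` replaces `F` by
  -- an open `G`. The Urysohn function between them is cut off inside `interior K`, so that the
  -- hypothesis applies to it.
  obtain ⟨f, hfs, hf1, hf01⟩ := exists_tsupport_one_of_isOpen_isClosed (hG.inter isOpen_interior)
    (hK.of_isClosed_subset isClosed_closure hcl) hF.isClosed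
    (subset_inter hFG (hFE.trans hEK))
  let f' : C_c(X, ℝ) := ⟨f, hK.of_isClosed_subset (isClosed_tsupport f)
    (hfs.trans (inter_subset_right.trans interior_subset))⟩
  have hmeas : Measurable fun x => ENNReal.ofReal (f x) := f.continuous.measurable.ennreal_ofReal
  have hint : ∀ κ : Measure X, κ.Regular →
      ∫⁻ x, ENNReal.ofReal (f x) ∂κ = ENNReal.ofReal (∫ x, f x ∂κ) := fun κ _ =>
    (ofReal_integral_eq_lintegral_ofReal f'.integrable (ae_of_all _ fun x => (hf01 x).1)).symm
  calc μ F = ∫⁻ x, F.indicator 1 x ∂μ := (lintegral_indicator_one hF.measurableSet).symm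
    _ ≤ ∫⁻ x, ENNReal.ofReal (f x) ∂μ := by
      refine lintegral_mono (indicator_le fun x hx => ?_)
      simp [hf1 hx]
    _ = ENNReal.ofReal (∫ x, f x ∂μ) := hint μ inferInstance
    _ ≤ ENNReal.ofReal (∫ x, f x ∂ν + ε) := ENNReal.ofReal_le_ofReal
      (h f' (hfs.trans (inter_subset_right.trans interior_subset)) hf01)
    _ ≤ ENNReal.ofReal (∫ x, f x ∂ν) + ENNReal.ofReal ε := ENNReal.ofReal_add_le
    _ = ∫⁻ x, ENNReal.ofReal (f x) ∂ν + ENNReal.ofReal ε := by rw [hint ν inferInstance]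
    _ ≤ ∫⁻ x, G.indicator 1 x ∂ν + ENNReal.ofReal ε := by
      gcongr with x
      by_cases hx : x ∈ G
      · simpa [hx] using (hf01 x).2
      · have : f x = 0 := image_eq_zero_of_notMem_tsupport fun hx' => hx (hfs hx').1
        simp [this]
    _ = ν G + ENNReal.ofReal ε := by rw [lintegral_indicator_one hG.measurableSet]

theorem withDensity_tsum_indicator {α : Type*} [MeasurableSpace α] (μ : Measure α)
    (a : ℕ → ℝ≥0∞) {C : ℕ → Set α} (hC : ∀ i, MeasurableSet (C i)) :
    μ.withDensity (fun x => ∑' i, (C i).indicator (fun _ => a i) x) =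
      Measure.sum fun i => a i • μ.restrict (C i) := by
  have : (fun x => ∑' i, (C i).indicator (fun _ => a i) x) =
      ∑' i, (C i).indicator (fun _ => a i) := by
    ext x
    rw [ENNReal.tsum_apply]
  rw [this, withDensity_tsum fun i => measurable_const.indicator (hC i)]
  congr 1
  ext1 i
  rw [withDensity_indicator (hC i), withDensity_const]

/-- If the density `θ` is a limit in `L¹` of integer-valued densities then it is almost everywhere
integer-valued. -/
theorem ae_mem_range_natCast_of_approx {α : Type*} [MeasurableSpace α] {μ : Measure α} {O : Set α}
    (hO : MeasurableSet O) {θ : α → ℝ≥0∞} (hθ : Measurable θ) (hfin : ∫⁻ x in O, θ x ∂μ ≠ ∞)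
    (happ : ∀ ε : ℝ≥0∞, 0 < ε → ∃ η : α → ℝ≥0∞, Measurable η ∧
      (∀ x, ∀ k : ℕ, η x ≤ k ∨ (k : ℝ≥0∞) + 1 ≤ η x) ∧
      ∀ E, MeasurableSet E → E ⊆ O →
        ∫⁻ x in E, θ x ∂μ ≤ ∫⁻ x in E, η x ∂μ + ε ∧ ∫⁻ x in E, η x ∂μ ≤ ∫⁻ x in E, θ x ∂μ + ε) :
    ∀ᵐ x ∂μ, x ∈ O → θ x ∈ range ((↑) : ℕ → ℝ≥0∞) := by
  -- If `θ` stays at distance at least `δ` from both `k` and `k + 1` on `E`, then so does `θ` from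
  -- `η`, which avoids the open interval between them. Testing separately where `η ≤ k` and where `k
  -- + 1 ≤ η` gives `δ * μ E ≤ 2 * ε`.
  have key : ∀ k l : ℕ, μ {x | x ∈ O ∧ (k : ℝ≥0∞) + (l + 1 : ℝ≥0∞)⁻¹ ≤ θ x ∧
      θ x + (l + 1 : ℝ≥0∞)⁻¹ ≤ k + 1} = 0 := by
    intro k l
    set δ : ℝ≥0∞ := (l + 1 : ℝ≥0∞)⁻¹ with hδ
    have hδ0 : δ ≠ 0 := by simp [hδ]
    have hδ1 : δ ≠ ∞ := by simp [hδ]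
    set E := {x | x ∈ O ∧ (k : ℝ≥0∞) + δ ≤ θ x ∧ θ x + δ ≤ k + 1} with hE
    have hEm : MeasurableSet E := hO.inter ((measurableSet_le measurable_const hθ).inter
      (measurableSet_le (hθ.add_const _) measurable_const))
    have hEO : E ⊆ O := fun x hx => hx.1
    have hlow : ∀ F ⊆ E, MeasurableSet F → (k + δ) * μ F ≤ ∫⁻ x in F, θ x ∂μ := fun F hF hFm => by
      rw [← setLIntegral_const]
      exact setLIntegral_mono hθ fun x hx => (hF hx).2.1
    -- Finiteness is needed to cancel `k * μ E₁` below; it follows from `θ ≥ δ > 0` on `E` and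
    -- integrability.
    have hEfin : μ E ≠ ∞ := by
      intro htop
      have h1 := hlow E subset_rfl hEm
      rw [htop, ENNReal.mul_top (by simp [hδ0])] at h1
      exact hfin (top_le_iff.1 (h1.trans (lintegral_mono_set hEO)))
    have hle : ∀ ε : ℝ≥0∞, 0 < ε → δ * μ E ≤ 2 * ε := by
      intro ε hε
      obtain ⟨η, hη, hηk, hηE⟩ := happ ε hε
      set E₁ := E ∩ {x | η x ≤ k} with hE₁
      set E₂ := E \ {x | η x ≤ k} with hE₂
      have hs : MeasurableSet {x | η x ≤ k} := measurableSet_le hη measurable_const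
      have hm₁ : MeasurableSet E₁ := hEm.inter hs
      have hm₂ : MeasurableSet E₂ := hEm.diff hs
      have h₁ : δ * μ E₁ ≤ ε := by
        have h2 : (k + δ) * μ E₁ ≤ k * μ E₁ + ε := calc
          (k + δ) * μ E₁ ≤ ∫⁻ x in E₁, θ x ∂μ := hlow _ inter_subset_left hm₁
          _ ≤ ∫⁻ x in E₁, η x ∂μ + ε := (hηE _ hm₁ (inter_subset_left.trans hEO)).1
          _ ≤ k * μ E₁ + ε := by
            gcongr
            rw [← setLIntegral_const]
            exact setLIntegral_mono measurable_const fun x hx => hx.2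
        rw [add_mul] at h2
        refine (ENNReal.add_le_add_iff_left ?_).1 h2
        exact ENNReal.mul_ne_top (by simp) (measure_ne_top_of_subset inter_subset_left hEfin)
      have h₂ : δ * μ E₂ ≤ ε := by
        have h2 : ∫⁻ x in E₂, θ x ∂μ + δ * μ E₂ ≤ ∫⁻ x in E₂, θ x ∂μ + ε := calc
          ∫⁻ x in E₂, θ x ∂μ + δ * μ E₂ = ∫⁻ x in E₂, (θ x + δ) ∂μ := by
            rw [lintegral_add_right _ measurable_const, setLIntegral_const]
          _ ≤ ∫⁻ x in E₂, η x ∂μ := setLIntegral_mono hη fun x hx =>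
            hx.1.2.2.trans ((hηk x k).resolve_left hx.2)
          _ ≤ ∫⁻ x in E₂, θ x ∂μ + ε := (hηE _ hm₂ (sdiff_subset.trans hEO)).2
        refine (ENNReal.add_le_add_iff_left ?_).1 h2
        exact ne_top_of_le_ne_top hfin (lintegral_mono_set (sdiff_subset.trans hEO))
      calc δ * μ E = δ * μ E₁ + δ * μ E₂ := by rw [← mul_add, measure_inter_add_sdiff _ hs]
        _ ≤ ε + ε := add_le_add h₁ h₂
        _ = 2 * ε := (two_mul ε).symm
    have h0 : δ * μ E ≤ 0 := by
      refine ge_of_tendsto (f := fun ε : ℝ≥0∞ => 2 * ε) (x := 𝓝[>] 0) ?_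
        (by filter_upwards [self_mem_nhdsWithin] with ε hε using hle ε hε)
      have := ENNReal.Tendsto.const_mul (a := 2) (tendsto_id (α := ℝ≥0∞) (x := 𝓝 0))
        (Or.inr (by simp))
      rw [mul_zero] at this
      exact this.mono_left nhdsWithin_le_nhds
    simpa [hδ0] using h0
  have hall := ae_all_iff.2 fun k => ae_all_iff.2 fun l => measure_eq_zero_iff_ae_notMem.1 (key k l)
  filter_upwards [hall, (ae_restrict_iff' hO).1 (ae_lt_top hθ hfin)] with x hx hx' hxO
  by_contra hcon
  obtain ⟨t, ht⟩ : ∃ t : ℝ≥0, θ x = t := ⟨_, (ENNReal.coe_toNNReal (hx' hxO).ne).symm⟩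
  have hk1 : (⌊t⌋₊ : ℝ≥0) < t := lt_of_le_of_ne (Nat.floor_le zero_le)
    fun h => hcon ⟨⌊t⌋₊, by rw [ht, ← h]; simp⟩
  have hk2 : t < ⌊t⌋₊ + 1 := Nat.lt_floor_add_one t
  obtain ⟨l, hl⟩ := exists_nat_one_div_lt
    (lt_min (tsub_pos_of_lt hk1) (tsub_pos_of_lt hk2))
  have hl' : ((l : ℝ≥0∞) + 1)⁻¹ = ((1 / ((l : ℝ≥0) + 1) : ℝ≥0) : ℝ≥0∞) := by
    rw [one_div, ENNReal.coe_inv (by positivity)]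
    simp
  refine hx ⌊t⌋₊ l ⟨hxO, ?_, ?_⟩
  · rw [ht, hl']
    have := (lt_tsub_iff_left.1 (hl.trans_le (min_le_left _ _))).le
    exact_mod_cast this
  · rw [ht, hl']
    have := (lt_tsub_iff_left.1 (hl.trans_le (min_le_right _ _))).le
    exact_mod_cast this

/-- A countable sum of constants from `ℕ` over sets containing a point skips the open intervals
between consecutive integers. -/
theorem _root_.ENNReal.tsum_natCast_le_or_add_one_le {ι : Type*} (a : ι → ℕ) (k : ℕ) :
    ∑' i, (a i : ℝ≥0∞) ≤ k ∨ (k : ℝ≥0∞) + 1 ≤ ∑' i, (a i : ℝ≥0∞) := by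
  refine or_iff_not_imp_left.2 fun h => ?_
  rw [not_le, ENNReal.tsum_eq_iSup_sum, lt_iSup_iff] at h
  obtain ⟨s, hs⟩ := h
  refine le_trans ?_ (ENNReal.sum_le_tsum s)
  have h1 : k < ∑ i ∈ s, a i := by exact_mod_cast hs
  exact_mod_cast Nat.succ_le_of_lt h1

/-- Every measurable function is a countable sum of positive multiples of characteristic
functions. -/
theorem _root_.Measurable.exists_eq_tsum_indicator {α : Type*} [MeasurableSpace α]
    {θ : α → ℝ≥0∞} (hθ : Measurable θ) : ∃ (c : ℕ → ℝ) (C : ℕ → Set α), (∀ i, 0 < c i) ∧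
      (∀ i, MeasurableSet (C i)) ∧
      ∀ x, θ x = ∑' i, (C i).indicator (fun _ => ENNReal.ofReal (c i)) x := by
  -- The positive values of the simple functions whose sum is `θ`. The positive integers are added
  -- only to make `S` infinite, so that `ℕ × S` is enumerated by `ℕ`; a value not attained at a
  -- given level has empty fibre there.
  let S : Set ℝ≥0 := {c | 0 < c ∧
    (c ∈ range ((↑) : ℕ → ℝ≥0) ∨ ∃ k, c ∈ range (SimpleFunc.eapproxDiff θ k))}
  have hScount : S.Countable := by
    refine ((countable_range ((↑) : ℕ → ℝ≥0)).union (countable_iUnion fun k =>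
      (SimpleFunc.finite_range (SimpleFunc.eapproxDiff θ k)).countable)).mono ?_
    rintro c ⟨_, h | ⟨k, hk⟩⟩
    · exact Or.inl h
    · exact Or.inr (mem_iUnion.2 ⟨k, hk⟩)
  have hSinf : S.Infinite := by
    refine (infinite_range_of_injective (f := fun k : ℕ => ((k + 1 : ℕ) : ℝ≥0))
      fun i j h => by simpa using h).mono ?_
    rintro _ ⟨k, rfl⟩
    exact ⟨by positivity, Or.inl ⟨_, rfl⟩⟩
  have := hScount.to_subtype
  have := hSinf.to_subtype
  obtain ⟨e⟩ : Nonempty (ℕ ≃ ℕ × S) := nonempty_equiv_of_countable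
  refine ⟨fun i => ((e i).2 : ℝ≥0), fun i => SimpleFunc.eapproxDiff θ (e i).1 ⁻¹' {((e i).2 : ℝ≥0)},
    fun i => (e i).2.2.1, fun i => SimpleFunc.measurableSet_fiber _ _, fun x => ?_⟩
  rw [← e.symm.tsum_eq]
  simp only [Equiv.apply_symm_apply, ENNReal.ofReal_coe_nnreal]
  rw [ENNReal.tsum_prod', ← SimpleFunc.tsum_eapproxDiff θ hθ x]
  refine tsum_congr fun k => ?_
  by_cases h0 : SimpleFunc.eapproxDiff θ k x = 0
  · rw [h0, ENNReal.coe_zero, eq_comm, ENNReal.tsum_eq_zero]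
    refine fun c => indicator_of_notMem (fun hc => c.2.1.ne ?_) _
    rw [← h0]
    exact hc
  · rw [tsum_eq_single ⟨SimpleFunc.eapproxDiff θ k x, pos_iff_ne_zero.2 h0, Or.inr ⟨k, x, rfl⟩⟩]
    · simp
    · intro c hc
      refine indicator_of_notMem (fun hc' => hc (Subtype.ext ?_)) _
      exact (show SimpleFunc.eapproxDiff θ k x = c from hc').symm

end MeasureTheory

namespace Varifold

variable {n m : ℕ} {U : Opens (EuclideanSpace ℝ (Fin n))}

/-! ### Measures carried by graphs -/

/-- The Radon measure on `U × 𝐆(n, m)` which is the push-forward of `ℋ^m ⌞ A` under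
`x ↦ (x, T x)`. -/
def graphMeasure (A : Set U) (T : U → Gr n m) : Measure (U × Gr n m) :=
  ((μHE[m] : Measure U).restrict A).map fun x => (x, T x)

/-- The weighted sum of the measures `graphMeasure (A i) (T i)`. -/
def sumMeasure (c : ℕ → ℝ) (A : ℕ → Set U) (T : ℕ → U → Gr n m) : Measure (U × Gr n m) :=
  Measure.sum fun i => ENNReal.ofReal (c i) • graphMeasure (A i) (T i)

theorem graphMeasure_apply {A : Set U} {T : U → Gr n m} (hT : Measurable T)
    {E : Set (U × Gr n m)} (hE : MeasurableSet E) :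
    graphMeasure A T E = (μHE[m] : Measure U).restrict A ((fun x => (x, T x)) ⁻¹' E) :=
  Measure.map_apply (measurable_id.prodMk hT) hE

theorem isFiniteMeasureOnCompacts_graphMeasure {A : Set U} {T : U → Gr n m} (hT : Measurable T)
    (hA : ∀ K, IsCompact K → (μHE[m] : Measure U) (A ∩ K) < ∞) :
    IsFiniteMeasureOnCompacts (graphMeasure A T) := by
  refine ⟨fun K hK => ?_⟩
  have hK' : IsCompact (Prod.fst '' K) := hK.image continuous_fst
  rw [graphMeasure_apply hT hK.measurableSet]
  refine lt_of_le_of_lt (measure_mono (t := Prod.fst '' K)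
    fun x hx => ⟨(x, T x), hx, rfl⟩) ?_
  rw [Measure.restrict_apply hK'.measurableSet, inter_comm]
  exact hA _ hK'

theorem integral_graphMeasure {A : Set U} {T : U → Gr n m} (hT : Measurable T)
    (f : C_c(U × Gr n m, ℝ)) :
    ∫ z, f z ∂(graphMeasure A T) = ∫ x in A, f (x, T x) ∂(μHE[m] : Measure U) :=
  integral_map (measurable_id.prodMk hT).aemeasurable f.continuous.aestronglyMeasurable

theorem hasSum_integral_sumMeasure {c : ℕ → ℝ} (hc : ∀ i, 0 ≤ c i) {A : ℕ → Set U}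
    {T : ℕ → U → Gr n m} (hT : ∀ i, Measurable (T i))
    [IsFiniteMeasureOnCompacts (sumMeasure c A T)] (f : C_c(U × Gr n m, ℝ)) :
    HasSum (fun i => c i * ∫ x in A i, f (x, T i x) ∂(μHE[m] : Measure U))
      (∫ z, f z ∂(sumMeasure c A T)) := by
  have h := hasSum_integral_measure (μ := fun i => ENNReal.ofReal (c i) • graphMeasure (A i) (T i))
    (f := f) (f.integrable (μ := sumMeasure c A T))
  have heq : ∀ i, ∫ z, f z ∂(ENNReal.ofReal (c i) • graphMeasure (A i) (T i)) =
      c i * ∫ x in A i, f (x, T i x) ∂(μHE[m] : Measure U) := fun i => by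
    rw [integral_smul_measure, integral_graphMeasure (hT i), ENNReal.toReal_ofReal (hc i),
      smul_eq_mul]
  simpa only [heq, sumMeasure] using h

/-- A test function equal to `1` on `K` dominates the mass of `K` in each term, and its integrals
are summable. -/
theorem isFiniteMeasureOnCompacts_sumMeasure {c : ℕ → ℝ} (hc : ∀ i, 0 ≤ c i) {A : ℕ → Set U}
    {T : ℕ → U → Gr n m} (hT : ∀ i, Measurable (T i))
    (hA : ∀ i K, IsCompact K → (μHE[m] : Measure U) (A i ∩ K) < ∞)
    (hsum : ∀ f : C_c(U × Gr n m, ℝ),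
      Summable fun i => c i * ∫ x in A i, f (x, T i x) ∂(μHE[m] : Measure U)) :
    IsFiniteMeasureOnCompacts (sumMeasure c A T) := by
  refine ⟨fun K hK => ?_⟩
  obtain ⟨f, hf1, -, hfc, hf01⟩ := exists_continuous_one_zero_of_isCompact hK isClosed_empty
    (disjoint_empty K)
  let f' : C_c(U × Gr n m, ℝ) := ⟨f, hfc⟩
  have hfin := fun i => isFiniteMeasureOnCompacts_graphMeasure (hT i) (hA i)
  have hnn : ∀ i, 0 ≤ c i * ∫ x in A i, f (x, T i x) ∂(μHE[m] : Measure U) := fun i =>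
    mul_nonneg (hc i) (integral_nonneg fun x => (hf01 _).1)
  have hint : ∀ i, graphMeasure (A i) (T i) K ≤
      ENNReal.ofReal (∫ x in A i, f (x, T i x) ∂(μHE[m] : Measure U)) := fun i => by
    have h1 := integral_graphMeasure (A := A i) (hT i) f'
    have h2 := ofReal_integral_eq_lintegral_ofReal (f'.integrable (μ := graphMeasure (A i) (T i)))
      (ae_of_all _ fun x => (hf01 x).1)
    rw [h1] at h2
    refine le_of_le_of_eq ?_ h2.symm
    rw [← lintegral_indicator_one hK.measurableSet]
    refine lintegral_mono (indicator_le fun x hx => ?_)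
    simp [f', hf1 hx]
  rw [sumMeasure, Measure.sum_apply _ hK.measurableSet]
  calc ∑' i, (ENNReal.ofReal (c i) • graphMeasure (A i) (T i)) K
      ≤ ∑' i, ENNReal.ofReal (c i * ∫ x in A i, f (x, T i x) ∂(μHE[m] : Measure U)) := by
        refine ENNReal.tsum_le_tsum fun i => ?_
        rw [ENNReal.ofReal_mul (hc i), Measure.smul_apply, smul_eq_mul]
        gcongr
        exact hint i
    _ = ENNReal.ofReal (∑' i, c i * ∫ x in A i, f (x, T i x) ∂(μHE[m] : Measure U)) :=
        (ENNReal.ofReal_tsum_of_nonneg hnn (hsum f')).symm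
    _ < ∞ := ENNReal.ofReal_lt_top

/-- The Riesz representation of varifolds. -/
theorem exists_measure (V : VarifoldSpace m U) : ∃ ν : Measure (U × Gr n m), ν.Regular ∧
    ∀ f : C_c(U × Gr n m, ℝ), V.1 f = ∫ z, f z ∂ν := by
  let Λ : C_c(U × Gr n m, ℝ) →ₚ[ℝ] ℝ := PositiveLinearMap.mk₀ V.1.toLinearMap fun f hf => V.2 f hf
  exact ⟨RealRMK.rieszMeasure Λ, inferInstance, fun f => (RealRMK.integral_rieszMeasure Λ f).symm⟩

theorem regular_sumMeasure_and_eq_integral {V : VarifoldSpace m U} {c : ℕ → ℝ}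
    (hc : ∀ i, 0 ≤ c i) {A : ℕ → Set U} {T : ℕ → U → Gr n m}
    (hA : ∀ i, IsLocallyRectifiable m U (A i)) (hT : ∀ i, Measurable (T i))
    (hV : ∀ f : C_c(U × Gr n m, ℝ),
      HasSum (fun i => c i * ∫ x in A i, f (x, T i x) ∂(μHE[m] : Measure U)) (V.1 f)) :
    (sumMeasure c A T).Regular ∧
      ∀ f : C_c(U × Gr n m, ℝ), V.1 f = ∫ z, f z ∂(sumMeasure c A T) := by
  have := isFiniteMeasureOnCompacts_sumMeasure hc hT
    (fun i K hK => (hA i).measure_inter_lt_top hK) fun f => (hV f).summable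
  have : IsLocallyFiniteMeasure (sumMeasure c A T) :=
    isLocallyFiniteMeasure_of_isFiniteMeasureOnCompacts
  exact ⟨inferInstance, fun f => (hV f).unique (hasSum_integral_sumMeasure hc hT f)⟩

/-! ### Gluing tangent fields -/

/-- Since the fields agree almost everywhere on overlaps, it suffices to take on each point the
field of the first set containing it, after shrinking the sets to Borel ones. -/
theorem exists_measurable_ae_eq {A : ℕ → Set U} {T : ℕ → U → Gr n m}
    (hA : ∀ i, IsLocallyRectifiable m U (A i)) (hT : ∀ i, IsTangentField m U (A i) (T i)) :
    ∃ S : U → Gr n m, Measurable S ∧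
      ∀ᵐ x ∂(μHE[m] : Measure U), ∀ i, x ∈ A i → S x = T i x := by
  choose A' hA'sub hA'm hA'eq using fun i => (hA i).1.exists_measurable_subset_ae_eq
  obtain ⟨S, hS, hST⟩ := exists_measurable_piecewise (disjointed A')
    (fun i => MeasurableSet.disjointed hA'm i) T (fun i => (hT i).1) fun i j hij x hx =>
      ((disjoint_disjointed A' hij).le_bot hx).elim
  refine ⟨S, hS, ?_⟩
  filter_upwards [ae_all_iff.2 fun i => ae_all_iff.2 fun j => (hT i).ae_eq (hA i) (hT j) (hA j),
    ae_all_iff.2 hA'eq] with x h1 h2 i hi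
  have hi' : x ∈ A' i := (h2 i).mpr hi
  have : x ∈ ⋃ k, disjointed A' k := by
    rw [iUnion_disjointed]
    exact mem_iUnion.2 ⟨i, hi'⟩
  obtain ⟨k, hk⟩ := mem_iUnion.1 this
  rw [hST k hk]
  exact h1 k i (hA'sub k (disjointed_subset A' k hk)) hi

theorem IsTangentField.of_subset_iUnion {A : ℕ → Set U} {T : ℕ → U → Gr n m}
    (hA : ∀ i, IsLocallyRectifiable m U (A i)) (hT : ∀ i, IsTangentField m U (A i) (T i))
    {S : U → Gr n m} (hS : Measurable S)
    (hST : ∀ᵐ x ∂(μHE[m] : Measure U), ∀ i, x ∈ A i → S x = T i x) {C : Set U}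
    (hC : NullMeasurableSet C (μHE[m] : Measure U))
    (hC' : ∀ K, IsCompact K → (μHE[m] : Measure U) (C ∩ K) < ∞) (hCA : C ⊆ ⋃ i, A i) :
    IsTangentField m U C S := by
  refine ⟨hS, (ae_restrict_iff'₀ hC).2 ?_⟩
  filter_upwards [hST, ae_all_iff.2 fun i => (hT i).ae_eq_approxTangentCone (hA i) hC hC']
    with x h1 h2 hx
  obtain ⟨i, hi⟩ := mem_iUnion.1 (hCA hx)
  rw [h1 i hi, h2 i hi hx]

/-- Hausdorff measure on `U` need not be σ-finite; restricting it to the countable union is what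
makes Radon–Nikodym available. -/
theorem sigmaFinite_restrict_iUnion {A : ℕ → Set U} (hA : ∀ i, IsLocallyRectifiable m U (A i)) :
    SigmaFinite ((μHE[m] : Measure U).restrict (⋃ i, A i)) := by
  have hR : NullMeasurableSet (⋃ i, A i) (μHE[m] : Measure U) := .iUnion fun i => (hA i).1
  refine Measure.sigmaFinite_of_countable (S := insert (⋃ i, A i)ᶜ
    (range fun p : ℕ × ℕ => A p.1 ∩ compactCovering U p.2)) ((countable_range _).insert _) ?_ ?_
  · rintro _ (rfl | ⟨p, rfl⟩)
    · rw [Measure.restrict_apply₀' hR, compl_inter_self, measure_empty]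
      exact ENNReal.zero_lt_top
    · exact (Measure.restrict_apply_le _ _).trans_lt
        ((hA p.1).measure_inter_lt_top (isCompact_compactCovering U p.2))
  · refine eq_univ_of_forall fun x => ?_
    by_cases hx : x ∈ ⋃ i, A i
    · obtain ⟨i, hi⟩ := mem_iUnion.1 hx
      obtain ⟨k, hk⟩ := exists_mem_compactCovering x
      exact ⟨_, Or.inr ⟨(i, k), rfl⟩, hi, hk⟩
    · exact ⟨_, Or.inl rfl, hx⟩

theorem sumMeasure_apply {c : ℕ → ℝ} {A : ℕ → Set U} {T : ℕ → U → Gr n m}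
    (hT : ∀ i, Measurable (T i)) {E : Set (U × Gr n m)} (hE : MeasurableSet E) :
    sumMeasure c A T E = ∑' i, ENNReal.ofReal (c i) *
      (μHE[m] : Measure U).restrict (A i) ((fun x => (x, T i x)) ⁻¹' E) := by
  rw [sumMeasure, Measure.sum_apply _ hE]
  refine tsum_congr fun i => ?_
  rw [Measure.smul_apply, graphMeasure_apply (hT i) hE, smul_eq_mul]

/-! ### Strongly convergent sequences of varifolds -/

/-- First countability is not needed: only one strong neighbourhood of `V` is used for each `j`. -/
theorem exists_seq_of_mem_closure {𝒮 : Set (VarifoldSpace m U)} {V : VarifoldSpace m U}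
    (hV : V ∈ closure 𝒮) (K : ℕ → Set U) (hK : ∀ j, IsCompact (K j)) :
    ∃ W : ℕ → VarifoldSpace m U, (∀ j, W j ∈ 𝒮) ∧ ∀ j, ∀ f : C_c(U × Gr n m, ℝ),
      tsupport f ⊆ K j ×ˢ univ → (∀ z, |f z| ≤ 1) → |(W j).1 f - V.1 f| ≤ 1 / ((j : ℝ) + 1) := by
  have h : ∀ j : ℕ, ∃ W ∈ 𝒮, ∀ f : C_c(U × Gr n m, ℝ),
      tsupport f ⊆ K j ×ˢ univ → (∀ z, |f z| ≤ 1) → |W.1 f - V.1 f| ≤ 1 / ((j : ℝ) + 1) := by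
    intro j
    have hev := continuous_subtype_val.continuousAt.eventually
      (Daniell.eventually_nhds_forall_abs_sub_le V.1
        (⟨K j ×ˢ univ, (hK j).prod isCompact_univ⟩ : Compacts (U × Gr n m))
        (by positivity : (0 : ℝ) < 1 / ((j : ℝ) + 1)))
    obtain ⟨W, hW, hWS⟩ := ((mem_closure_iff_frequently.1 hV).and_eventually hev).exists
    exact ⟨W, hW, hWS⟩
  choose W hW hWV using h
  exact ⟨W, hW, hWV⟩

theorem measure_approx {V W : VarifoldSpace m U} {μ ν : Measure (U × Gr n m)} [μ.Regular]
    [ν.Regular] (hμ : ∀ f : C_c(U × Gr n m, ℝ), W.1 f = ∫ z, f z ∂μ)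
    (hν : ∀ f : C_c(U × Gr n m, ℝ), V.1 f = ∫ z, f z ∂ν) {K : Set U} (hK : IsCompact K) {ε : ℝ}
    (h : ∀ f : C_c(U × Gr n m, ℝ), tsupport f ⊆ K ×ˢ univ → (∀ z, |f z| ≤ 1) →
      |W.1 f - V.1 f| ≤ ε) {E : Set (U × Gr n m)} (hE : MeasurableSet E)
    (hEK : E ⊆ Prod.fst ⁻¹' interior K) :
    ν E ≤ μ E + ENNReal.ofReal ε ∧ μ E ≤ ν E + ENNReal.ofReal ε := by
  have hKc : IsCompact (K ×ˢ (univ : Set (Gr n m))) := hK.prod isCompact_univ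
  have hEK' : E ⊆ interior (K ×ˢ (univ : Set (Gr n m))) := by
    rw [interior_prod_eq, interior_univ]
    exact fun z hz => ⟨hEK hz, mem_univ _⟩
  have habs : ∀ f : C_c(U × Gr n m, ℝ), (∀ z, 0 ≤ f z ∧ f z ≤ 1) → ∀ z, |f z| ≤ 1 :=
    fun f hf z => abs_le.2 ⟨by linarith [(hf z).1], (hf z).2⟩
  constructor
  · refine measure_le_add_of_forall_integral_le hKc (fun f hf hf01 => ?_) hE hEK'
    rw [← hμ, ← hν]
    linarith [(abs_le.1 (h f hf (habs f hf01))).1]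
  · refine measure_le_add_of_forall_integral_le hKc (fun f hf hf01 => ?_) hE hEK'
    rw [← hμ, ← hν]
    linarith [(abs_le.1 (h f hf (habs f hf01))).2]

/-- Strong limits of varifolds given by sums over rectifiable sets are carried by the graph of one
tangent field over a countable union of such sets, with a density; the density is integer-valued
if the coefficients are. -/
theorem exists_density_of_mem_closure {Q : ℝ → Prop} {V : VarifoldSpace m U}
    (hV : V ∈ closure {V : VarifoldSpace m U |
      ∃ c : ℕ → ℝ, (∀ i, 0 < c i ∧ Q (c i)) ∧ V.IsSum c}) :
    ∃ (A : ℕ → Set U) (S : U → Gr n m) (θ : U → ℝ≥0∞),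
      (∀ i, IsLocallyRectifiable m U (A i)) ∧ Measurable S ∧
      (∀ C : Set U, NullMeasurableSet C (μHE[m] : Measure U) →
        (∀ K, IsCompact K → (μHE[m] : Measure U) (C ∩ K) < ∞) → C ⊆ ⋃ i, A i →
        IsTangentField m U C S) ∧
      Measurable θ ∧
      ((((μHE[m] : Measure U).restrict (⋃ i, A i)).withDensity θ).map fun x => (x, S x)).Regular ∧
      (∀ f : C_c(U × Gr n m, ℝ), V.1 f = ∫ z, f z
        ∂((((μHE[m] : Measure U).restrict (⋃ i, A i)).withDensity θ).map fun x => (x, S x))) ∧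
      ((∀ t, Q t → ∃ k : ℕ, t = k) →
        ∀ᵐ x ∂((μHE[m] : Measure U).restrict (⋃ i, A i)), θ x ∈ range ((↑) : ℕ → ℝ≥0∞)) := by
  let K := CompactExhaustion.choice U
  obtain ⟨W, hW, hWV⟩ := exists_seq_of_mem_closure hV K K.isCompact
  choose c hc A T hA hT hsum using hW
  obtain ⟨S, hS, hST⟩ := exists_measurable_ae_eq (m := m) (U := U)
    (A := fun p => A p.unpair.1 p.unpair.2) (T := fun p => T p.unpair.1 p.unpair.2)
    (fun p => hA _ _) (fun p => hT _ _)
  have hR : NullMeasurableSet (⋃ p : ℕ, A p.unpair.1 p.unpair.2) (μHE[m] : Measure U) :=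
    .iUnion fun p => (hA _ _).1
  have hσ : SigmaFinite ((μHE[m] : Measure U).restrict (⋃ p : ℕ, A p.unpair.1 p.unpair.2)) :=
    sigmaFinite_restrict_iUnion fun p => hA _ _
  have hAR : ∀ j i, A j i ⊆ ⋃ p : ℕ, A p.unpair.1 p.unpair.2 := fun j i x hx =>
    mem_iUnion.2 ⟨Nat.pair j i, by simpa using hx⟩
  have hST' : ∀ᵐ x ∂(μHE[m] : Measure U), ∀ j i, x ∈ A j i → S x = T j i x := by
    filter_upwards [hST] with x hx j i hi
    simpa using hx (Nat.pair j i) (by simpa using hi)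
  set R := ⋃ p : ℕ, A p.unpair.1 p.unpair.2 with hRdef
  set lam := (μHE[m] : Measure U).restrict R with hlam
  have hc0 : ∀ j i, 0 ≤ c j i := fun j i => (hc j i).1.le
  have hTm : ∀ j i, Measurable (T j i) := fun j i => (hT j i).1
  have hμ := fun j => regular_sumMeasure_and_eq_integral (hc0 j) (hA j) (hTm j) (hsum j)
  have hμreg := fun j => (hμ j).1
  obtain ⟨ν, hνreg, hν⟩ := exists_measure V
  have happ : ∀ l j, l ≤ j → ∀ E, MeasurableSet E → E ⊆ Prod.fst ⁻¹' interior (K l) →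
      ν E ≤ sumMeasure (c j) (A j) (T j) E + ENNReal.ofReal (1 / ((j : ℝ) + 1)) ∧
      sumMeasure (c j) (A j) (T j) E ≤ ν E + ENNReal.ofReal (1 / ((j : ℝ) + 1)) :=
    fun l j hlj E hE hEl => measure_approx (hμ j).2 hν (K.isCompact j) (hWV j) hE
      (hEl.trans (preimage_mono (interior_mono (K.subset hlj))))
  have hlim : Tendsto (fun j : ℕ => ENNReal.ofReal (1 / ((j : ℝ) + 1))) atTop (𝓝 0) := by
    simpa using ENNReal.tendsto_ofReal (tendsto_one_div_add_atTop_nhds_zero_nat (𝕜 := ℝ))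
  have hcover : (⋃ l, interior (K l)) = univ := by
    refine eq_univ_of_forall fun x => ?_
    obtain ⟨l, hl⟩ := mem_iUnion.1 (K.iUnion_eq ▸ mem_univ x : x ∈ ⋃ l, K l)
    exact mem_iUnion.2 ⟨l + 1, K.subset_interior_succ l hl⟩
  -- Over `interior (K l)`, every `j ≥ l` gives `ν ≤ 0 + 1 / (j + 1)`. This transfers to `ν` both
  -- the concentration on the graph and the absolute continuity.
  have hnull : ∀ E, MeasurableSet E → (∀ j, sumMeasure (c j) (A j) (T j) E = 0) → ν E = 0 := by
    intro E hE h0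
    have hE' : E = ⋃ l, E ∩ Prod.fst ⁻¹' interior (K l) := by
      rw [← inter_iUnion, ← preimage_iUnion, hcover, preimage_univ, inter_univ]
    rw [hE']
    refine measure_iUnion_null fun l => le_antisymm ?_ zero_le
    refine ge_of_tendsto hlim ?_
    filter_upwards [eventually_ge_atTop l] with j hj
    refine (happ l j hj _ (hE.inter (measurable_fst isOpen_interior.measurableSet))
      inter_subset_right).1.trans_eq ?_
    rw [measure_mono_null inter_subset_left (h0 j), zero_add]
  have hgraph : ∀ᵐ z ∂ν, z.2 = S z.1 := by
    have hN : MeasurableSet {z : U × Gr n m | z.2 = S z.1} :=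
      measurableSet_eq_fun measurable_snd (hS.comp measurable_fst)
    refine hnull _ hN.compl fun j => ?_
    rw [sumMeasure_apply (hTm j) hN.compl, ENNReal.tsum_eq_zero]
    intro i
    refine mul_eq_zero_of_right _ ?_
    have : ∀ᵐ x ∂(μHE[m] : Measure U).restrict (A j i), T j i x = S x :=
      (ae_restrict_iff'₀ (hA j i).1).2
        (by filter_upwards [hST'] with x hx hxA using (hx j i hxA).symm)
    exact this
  have hνσ : SigmaFinite ν := inferInstance
  set ν₁ := ν.map Prod.fst with hν₁
  have hν₁apply : ∀ {E : Set U}, MeasurableSet E → ν₁ E = ν (Prod.fst ⁻¹' E) := fun hE =>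
    Measure.map_apply measurable_fst hE
  have hac : ν₁ ≪ lam := by
    refine Measure.AbsolutelyContinuous.mk fun E hE h0 => ?_
    rw [hν₁apply hE]
    refine hnull _ (measurable_fst hE) fun j => ?_
    rw [sumMeasure_apply (hTm j) (measurable_fst hE), ENNReal.tsum_eq_zero]
    exact fun i => mul_eq_zero_of_right _
      ((Measure.restrict_mono_set _ (hAR j i)).absolutelyContinuous h0)
  have hθ : lam.withDensity (ν₁.rnDeriv lam) = ν₁ := Measure.withDensity_rnDeriv_eq _ _ hac
  have hgm : Measurable fun x => (x, S x) := measurable_id.prodMk hS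
  -- A measure carried by the graph of `S` is recovered from its projection to `U`.
  have hνmap : ν₁.map (fun x => (x, S x)) = ν := by
    ext E hE
    rw [Measure.map_apply hgm hE, hν₁apply (hgm hE)]
    refine measure_congr (eventuallyEq_set.2 ?_)
    filter_upwards [hgraph] with z hz
    have : (z.1, S z.1) = z := Prod.ext rfl hz.symm
    rw [mem_preimage, mem_preimage, this]
  refine ⟨fun p => A p.unpair.1 p.unpair.2, S, ν₁.rnDeriv lam, fun p => hA _ _, hS,
    fun C hC hC' hCA => IsTangentField.of_subset_iUnion (fun p => hA _ _) (fun p => hT _ _)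
      hS hST hC hC' hCA, Measure.measurable_rnDeriv _ _, ?_, ?_, fun hQ => ?_⟩
  · rw [← hRdef, ← hlam, hθ, hνmap]
    exact hνreg
  · rw [← hRdef, ← hlam, hθ, hνmap]
    exact hν
  rw [← hRdef, ← hlam]
  -- Borel representatives of the null-measurable sets, so that the approximating densities `η` are
  -- Borel functions.
  choose A' _ hA'm hA'eq using fun j i => (hA j i).1.exists_measurable_superset_ae_eq
  have hpiece : ∀ l, ∀ᵐ x ∂lam, x ∈ interior (K l) →
      ν₁.rnDeriv lam x ∈ range ((↑) : ℕ → ℝ≥0∞) := by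
    intro l
    have hint : ∀ E, MeasurableSet E → ∫⁻ x in E, ν₁.rnDeriv lam x ∂lam = ν (Prod.fst ⁻¹' E) :=
      fun E hE => by rw [← withDensity_apply _ hE, hθ, hν₁apply hE]
    refine ae_mem_range_natCast_of_approx isOpen_interior.measurableSet
      (Measure.measurable_rnDeriv _ _) ?_ fun ε hε => ?_
    · rw [hint _ isOpen_interior.measurableSet]
      refine ((measure_mono (t := K l ×ˢ univ) fun z hz => ⟨interior_subset hz, mem_univ _⟩).trans_lt
        ((K.isCompact l).prod isCompact_univ).measure_lt_top).ne
    · obtain ⟨j, hjε, hj⟩ := ((hlim.eventually (gt_mem_nhds hε)).and (eventually_ge_atTop l)).exists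
      refine ⟨fun x => ∑' i, (A' j i).indicator (fun _ => ENNReal.ofReal (c j i)) x,
        Measurable.tsum fun i => measurable_const.indicator (hA'm j i), fun x k => ?_, ?_⟩
      · choose a ha using fun i => hQ _ (hc j i).2
        have : ∀ i, (A' j i).indicator (fun _ => ENNReal.ofReal (c j i)) x =
            (((A' j i).indicator (fun _ => a i) x : ℕ) : ℝ≥0∞) := fun i => by
          by_cases hx : x ∈ A' j i
          · simp [hx, ha]
          · simp [hx]
        simp only [this]
        exact ENNReal.tsum_natCast_le_or_add_one_le _ k
      · intro E hE hEl
        have hη : ∫⁻ x in E, ∑' i, (A' j i).indicator (fun _ => ENNReal.ofReal (c j i)) x ∂lam =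
            sumMeasure (c j) (A j) (T j) (Prod.fst ⁻¹' E) := by
          rw [← withDensity_apply _ hE, withDensity_tsum_indicator _ _ (hA'm j),
            Measure.sum_apply _ hE, sumMeasure_apply (hTm j) (measurable_fst hE)]
          refine tsum_congr fun i => ?_
          have hres : lam.restrict (A' j i) = (μHE[m] : Measure U).restrict (A j i) := by
            rw [hlam, Measure.restrict_restrict (hA'm j i)]
            refine Measure.restrict_congr_set (((hA'eq j i).inter (ae_eq_refl R)).trans ?_)
            rw [inter_eq_left.2 (hAR j i)]
            exact ae_eq_refl _
          rw [Measure.smul_apply, hres, smul_eq_mul]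
          rfl
        rw [hint E hE, hη]
        obtain ⟨h1, h2⟩ := happ l j hj _ (measurable_fst hE) (preimage_mono hEl)
        exact ⟨h1.trans (by gcongr), h2.trans (by gcongr)⟩
  have hall := ae_all_iff.2 hpiece
  filter_upwards [hall] with x hx
  obtain ⟨l, hl⟩ := mem_iUnion.1 (hcover ▸ mem_univ x)
  exact hx l hl

/-- A varifold carried by the graph of a tangent field with density `∑ i, c i 1_{C i}` is the
sum of the varifolds of the sets `C i` with coefficients `c i`. -/
theorem isSum_of_density {V : VarifoldSpace m U} {A : ℕ → Set U} {S : U → Gr n m}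
    {θ : U → ℝ≥0∞} (hA : ∀ i, IsLocallyRectifiable m U (A i)) (hS : Measurable S)
    (htan : ∀ C : Set U, NullMeasurableSet C (μHE[m] : Measure U) →
      (∀ K, IsCompact K → (μHE[m] : Measure U) (C ∩ K) < ∞) → C ⊆ ⋃ i, A i →
      IsTangentField m U C S)
    (hreg : ((((μHE[m] : Measure U).restrict (⋃ i, A i)).withDensity θ).map
      fun x => (x, S x)).Regular)
    (hV : ∀ f : C_c(U × Gr n m, ℝ), V.1 f = ∫ z, f z
      ∂((((μHE[m] : Measure U).restrict (⋃ i, A i)).withDensity θ).map fun x => (x, S x)))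
    {c : ℕ → ℝ} (hc : ∀ i, 0 < c i) {C : ℕ → Set U} (hC : ∀ i, MeasurableSet (C i))
    (hθ : θ =ᵐ[(μHE[m] : Measure U).restrict (⋃ i, A i)]
      fun x => ∑' i, (C i).indicator (fun _ => ENNReal.ofReal (c i)) x) :
    V.IsSum c := by
  have hgm : Measurable fun x => (x, S x) := measurable_id.prodMk hS
  have hR : NullMeasurableSet (⋃ i, A i) (μHE[m] : Measure U) := .iUnion fun i => (hA i).1
  have heq : (((μHE[m] : Measure U).restrict (⋃ i, A i)).withDensity θ).map (fun x => (x, S x)) =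
      sumMeasure c (fun i => C i ∩ ⋃ i, A i) (fun _ => S) := by
    rw [withDensity_congr_ae hθ, withDensity_tsum_indicator _ _ hC,
      Measure.map_sum hgm.aemeasurable, sumMeasure]
    congr 1
    ext1 i
    rw [Measure.map_smul, Measure.restrict_restrict (hC i), graphMeasure]
  rw [heq] at hreg hV
  -- Since `c i > 0`, the local finiteness of the measure of `V` bounds the Hausdorff measure of
  -- each piece.
  have hfin : ∀ i K, IsCompact K → (μHE[m] : Measure U) ((C i ∩ ⋃ i, A i) ∩ K) < ∞ := by
    intro i K hK
    have h1 : ENNReal.ofReal (c i) * (μHE[m] : Measure U) ((C i ∩ ⋃ i, A i) ∩ K) ≤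
        sumMeasure c (fun i => C i ∩ ⋃ i, A i) (fun _ => S) (K ×ˢ univ) := by
      rw [sumMeasure_apply (fun _ => hS) (hK.prod isCompact_univ).measurableSet]
      refine le_trans (le_of_eq ?_) (ENNReal.le_tsum i)
      have : (fun x => (x, S x)) ⁻¹' (K ×ˢ univ) = K := by ext; simp
      rw [this, Measure.restrict_apply hK.measurableSet, inter_comm]
    have h2 := h1.trans_lt (hK.prod isCompact_univ).measure_lt_top
    exact ENNReal.lt_top_of_mul_ne_top_right h2.ne (by simpa using hc i)
  have hCn : ∀ i, NullMeasurableSet (C i ∩ ⋃ i, A i) (μHE[m] : Measure U) := fun i =>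
    (hC i).nullMeasurableSet.inter hR
  refine ⟨fun i => C i ∩ ⋃ i, A i, fun _ => S, fun i => ?_, fun i => ?_, fun f => ?_⟩
  · exact .of_subset_iUnion hA (hCn i) (hfin i) inter_subset_right
  · exact htan _ (hCn i) (hfin i) inter_subset_right
  · rw [hV f]
    exact hasSum_integral_sumMeasure (fun i => (hc i).le) (fun _ => hS) f

/-! ### Closedness of the two classes. -/

variable (m U)

theorem isClosed_rectifiableVarifolds :
    IsClosed (rectifiableVarifolds m U) := by
  refine isClosed_of_closure_subset fun V hV => ?_
  obtain ⟨A, S, θ, hA, hS, htan, hθ, hreg, hVf, -⟩ := exists_density_of_mem_closure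
    (Q := fun _ => True) (closure_mono (fun V hV => by
      obtain ⟨c, hc, h⟩ := hV
      exact ⟨c, fun i => ⟨hc i, trivial⟩, h⟩) hV)
  obtain ⟨c, C, hc, hC, hsum⟩ := hθ.exists_eq_tsum_indicator
  exact ⟨c, hc, isSum_of_density hA hS htan hreg hVf hc hC (ae_of_all _ hsum)⟩

theorem isClosed_integralVarifolds :
    IsClosed (integralVarifolds m U) := by
  refine isClosed_of_closure_subset fun V hV => ?_
  obtain ⟨A, S, θ, hA, hS, htan, hθ, hreg, hVf, hint⟩ := exists_density_of_mem_closure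
    (Q := fun t => ∃ k : ℕ, t = k) (closure_mono (fun V hV => by
      obtain ⟨c, hc, h⟩ := hV
      exact ⟨fun i => c i, fun i => ⟨Nat.cast_pos.2 (hc i), c i, rfl⟩, h⟩) hV)
  -- The level set `θ = i + 1` receives the coefficient `i + 1`; the shift keeps the coefficients
  -- positive, and the level set `θ = 0` contributes nothing.
  refine ⟨fun i => i + 1, fun i => i.succ_pos, isSum_of_density hA hS htan hreg hVf
    (fun i => by positivity) (C := fun i => θ ⁻¹' {((i + 1 : ℕ) : ℝ≥0∞)})
    (fun i => hθ (measurableSet_singleton _)) ?_⟩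
  filter_upwards [hint fun t ht => ht] with x hx
  obtain ⟨k, hk⟩ := hx
  rcases k with _ | k
  · rw [← hk, eq_comm, Nat.cast_zero, ENNReal.tsum_eq_zero]
    refine fun i => indicator_of_notMem (fun hi => ?_) _
    rw [mem_preimage, ← hk, mem_singleton_iff, Nat.cast_inj] at hi
    omega
  · rw [tsum_eq_single k]
    · rw [indicator_of_mem (by rw [mem_preimage, ← hk]; rfl), ENNReal.ofReal_natCast, hk]
    · intro i hi
      refine indicator_of_notMem (fun hi' => hi ?_) _
      rw [mem_preimage, ← hk, mem_singleton_iff, Nat.cast_inj] at hi'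
      omega

end Varifold

end

theorem mainTheorem5 (m n : ℕ) (hm : 0 < m) (hmn : m ≤ n)
    (U : TopologicalSpace.Opens (EuclideanSpace ℝ (Fin n))) :
    IsClosed (rectifiableVarifolds m U) ∧ IsClosed (integralVarifolds m U) :=
  ⟨Varifold.isClosed_rectifiableVarifolds m U, Varifold.isClosed_integralVarifolds m U⟩
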